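/- Let $\gamma$ be Euler's constant, $H_m=\sum_{j=1}^m \frac1j$ (with $H_0=0$), and let $\zeta$ be the Riemann zeta function (analytically continued). For $s\in\mathbb{C}$ and integers $n\ge 0$ put $\binom{s}{n}=\frac{s(s-1)\cdots(s-n+1)}{n!}$. Define $b_0=\frac12$ and, for $n\ge 1$, $$b_n=n\,(1-\gamma-H_{n-1})-\frac12+\sum_{k=2}^{n}\binom{n}{k}(-1)^k\zeta(k).$$ Let $Z(s)=\zeta(s)-\frac{1}{s-1}$ for $s\in\mathbb{C}\setminus\{1\}$ and $Z(1)=\gamma$. Then for every $s\in\mathbb{C}$ the Newton series $\sum_{n=0}^{\infty}(-1)^n b_n\binom{s}{n}$ converges (even absolutely), and $$\sum_{n=0}^{\infty}(-1)^n b_n\binom{s}{n}=Z(s).$$ -/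

import Mathlib

noncomputable section

namespace NewtonZeta

/-- The coefficients `b_n = n (1 - γ - H_{n-1}) - 1/2 + ∑_{k=2}^n C(n,k) (-1)^k ζ(k)`.
For `n = 0` the product `n * H_{n-1} = n * H_n - 1` is read as `-1`, so that `b_0 = 1/2`,
the value of `ζ(s) - 1/(s-1)` at `s = 0`. -/
def b : ℕ → ℂ
  | 0 => 1 / 2
  | m + 1 =>
      ((m + 1 : ℕ) : ℂ) * (1 - (Real.eulerMascheroniConstant : ℂ) - ((harmonic m : ℚ) : ℂ)) - 1 / 2
        + ∑ k ∈ Finset.Icc 2 (m + 1),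
            ((m + 1).choose k : ℂ) * (-1) ^ k * riemannZeta (k : ℂ)

/-- The function `ζ(s) - 1/(s-1)`, with its limit `γ` as the value at `s = 1`. -/
def Z (s : ℂ) : ℂ :=
  if s = 1 then (Real.eulerMascheroniConstant : ℂ) else riemannZeta s - 1 / (s - 1)

end NewtonZeta

end

/-! For real `s ≥ 1`, `Z(s) = 1/2 - s ∫_1^∞ ({x} - 1/2) x^{-s-1} dx` (`Z_ofReal`). Expanding
`x^{-(s-1)} = (1 - (1 - 1/x))^{s-1}` in powers of `1 - 1/x` and using `s C(s-1,m) = (m+1) C(s,m+1)`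
gives a Newton series whose coefficients are `(m+1) ∫ ({x} - 1/2) (1 - 1/x)^m x^{-2} dx`. These are
the `b (m+1)` (`b_succ`), because `b n` is the alternating binomial sum of `Z(0), ..., Z(n)`.

Repeated integration by parts against periodic antiderivatives of the sawtooth shows that `b n`
decays faster than every power of `n` (`b_isBigO`), while `C(s,n)` grows at most polynomially,
locally uniformly in `s` (`norm_choose_le`). The series is therefore entire. It equals `Z` on
`[1,2]`, hence everywhere by the identity theorem. -/

namespace NewtonZeta

open MeasureTheory Set Filter Topology

/-! ### Periodic antiderivatives of mean zero -/

/-- Bounded measurable 1-periodic functions of mean zero whose discontinuities are integers. -/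
structure PeriodicMeanZero (P : ℝ → ℝ) : Prop where
  measurable : Measurable P
  periodic : Function.Periodic P 1
  mean : ∫ x in (0 : ℝ)..1, P x = 0
  bounded : ∃ M, ∀ x, |P x| ≤ M
  continuousAt : ∀ x ∉ range ((↑) : ℤ → ℝ), ContinuousAt P x

namespace PeriodicMeanZero

variable {P : ℝ → ℝ}

theorem intervalIntegrable (hP : PeriodicMeanZero P) (a b : ℝ) :
    IntervalIntegrable P volume a b := by
  obtain ⟨M, hM⟩ := hP.bounded
  refine (intervalIntegrable_const (c := M)).mono_fun hP.measurable.aestronglyMeasurable ?_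
  filter_upwards with x
  simpa using (hM x).trans (le_abs_self M)

theorem continuous_integral (hP : PeriodicMeanZero P) :
    Continuous fun x => ∫ t in (0 : ℝ)..x, P t :=
  intervalIntegral.continuous_primitive (fun _ _ => hP.intervalIntegrable _ _) 0

theorem periodic_integral (hP : PeriodicMeanZero P) :
    Function.Periodic (fun x => ∫ t in (0 : ℝ)..x, P t) 1 := by
  intro x
  have h1 := intervalIntegral.integral_add_adjacent_intervals
    (hP.intervalIntegrable 0 x) (hP.intervalIntegrable x (x + 1))
  have h2 := hP.periodic.intervalIntegral_add_eq x 0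
  rw [zero_add, hP.mean] at h2
  simp only
  rw [← h1, h2, add_zero]

/-- Mean zero makes the primitive periodic; subtracting its own mean `c` restores mean zero, so the
construction can be iterated. -/
theorem exists_antideriv (hP : PeriodicMeanZero P) :
    ∃ Q : ℝ → ℝ, PeriodicMeanZero Q ∧ Continuous Q ∧
      ∀ x ∉ range ((↑) : ℤ → ℝ), HasDerivAt Q (P x) x := by
  set c := ∫ x in (0 : ℝ)..1, ∫ t in (0 : ℝ)..x, P t with hc
  have hcont : Continuous fun x => (∫ t in (0 : ℝ)..x, P t) - c :=
    hP.continuous_integral.sub continuous_const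
  have hper : Function.Periodic (fun x => (∫ t in (0 : ℝ)..x, P t) - c) 1 := by
    intro x
    have := hP.periodic_integral x
    simp only at this ⊢
    rw [this]
  refine ⟨fun x => (∫ t in (0 : ℝ)..x, P t) - c, ⟨hcont.measurable, hper, ?_, ?_,
    fun x _ => hcont.continuousAt⟩, hcont, ?_⟩
  · rw [intervalIntegral.integral_sub (hP.continuous_integral.intervalIntegrable _ _)
      intervalIntegrable_const]
    simp [hc]
  · obtain ⟨M, hM⟩ := (isCompact_Icc (a := (0 : ℝ)) (b := 1)).exists_bound_of_continuousOn
      hcont.continuousOn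
    refine ⟨M, fun x => ?_⟩
    obtain ⟨y, hy, hxy⟩ := hper.exists_mem_Ico₀ one_pos x
    rw [hxy]
    exact hM y (Ico_subset_Icc_self hy)
  · intro x hx
    exact (intervalIntegral.integral_hasDerivAt_right (hP.intervalIntegrable 0 x)
      hP.measurable.stronglyMeasurable.stronglyMeasurableAtFilter
      (hP.continuousAt x hx)).sub_const c

end PeriodicMeanZero

/-! ### Weighted integrals and their decay -/

/-- The weight `(1 - 1/x)^a x^{-(c+2)}`. -/
noncomputable def weight (a c : ℕ) (x : ℝ) : ℝ := (1 - x⁻¹) ^ a * x⁻¹ ^ (c + 2)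

/-- A single term of the expansion of `(u + (1 - u))^(a+c) = 1` is at most `1`, and its binomial
coefficient is at least `(a+1)^c / c!`. -/
theorem pow_mul_pow_le {u : ℝ} (h0 : 0 ≤ u) (h1 : u ≤ 1) (a c : ℕ) :
    (1 - u) ^ a * u ^ c ≤ c.factorial / ((a : ℝ) + 1) ^ c := by
  have hchoose : ((a : ℝ) + 1) ^ c / c.factorial ≤ ((a + c).choose c : ℝ) := by
    have := Nat.pow_le_choose (α := ℝ) c (a + c)
    rw [show a + c + 1 - c = a + 1 by omega] at this
    exact_mod_cast this
  have hbin : (1 - u) ^ a * u ^ c * ((a + c).choose c : ℝ) ≤ 1 := by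
    have h := add_pow u (1 - u) (a + c)
    rw [add_sub_cancel, one_pow] at h
    have := Finset.single_le_sum (s := Finset.range (a + c + 1))
      (f := fun m => u ^ m * (1 - u) ^ (a + c - m) * ((a + c).choose m : ℝ))
      (fun m _ => by have := sub_nonneg.2 h1; positivity)
      (Finset.mem_range.2 (show c < a + c + 1 by omega))
    simp only [Nat.add_sub_cancel] at this
    rw [mul_comm (u ^ c)] at this
    exact this.trans h.ge
  have h1u := sub_nonneg.2 h1
  have hpos : (0 : ℝ) < ((a : ℝ) + 1) ^ c := by positivity
  have hf : (0 : ℝ) < c.factorial := by positivity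
  rw [le_div_iff₀ hpos]
  have h2 := mul_le_mul_of_nonneg_left hchoose (show 0 ≤ (1 - u) ^ a * u ^ c by positivity)
  have h3 := h2.trans hbin
  rw [mul_div_assoc', div_le_one hf] at h3
  exact h3

theorem weight_nonneg {x : ℝ} (hx : 1 ≤ x) (a c : ℕ) : 0 ≤ weight a c x := by
  have h1 : x⁻¹ ≤ 1 := inv_le_one_of_one_le₀ hx
  have h0 : 0 ≤ x⁻¹ := by positivity
  have := sub_nonneg.2 h1
  unfold weight
  positivity

theorem weight_le {x : ℝ} (hx : 1 ≤ x) (a c : ℕ) :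
    weight a c x ≤ c.factorial / ((a : ℝ) + 1) ^ c * x⁻¹ ^ 2 := by
  have h1 : x⁻¹ ≤ 1 := inv_le_one_of_one_le₀ hx
  have h0 : 0 ≤ x⁻¹ := by positivity
  rw [weight, pow_add, ← mul_assoc]
  exact mul_le_mul_of_nonneg_right (pow_mul_pow_le h0 h1 a c) (by positivity)

theorem integrableOn_inv_sq : IntegrableOn (fun x : ℝ => x⁻¹ ^ 2) (Ioi 1) := by
  refine (integrableOn_Ioi_rpow_of_lt (a := -2) (by norm_num) one_pos).congr_fun
    (fun x hx => ?_) measurableSet_Ioi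
  have : (0 : ℝ) < x := one_pos.trans hx
  simp only
  rw [Real.rpow_neg this.le, inv_pow]
  norm_cast

theorem measurable_weight (a c : ℕ) : Measurable (weight a c) := by
  unfold weight
  fun_prop

variable {P : ℝ → ℝ}

theorem PeriodicMeanZero.norm_mul_weight_le {M : ℝ} (hM : ∀ x, |P x| ≤ M) (a c : ℕ) {x : ℝ}
    (hx : 1 ≤ x) :
    ‖P x * weight a c x‖ ≤ M * (c.factorial / ((a : ℝ) + 1) ^ c) * x⁻¹ ^ 2 := by
  have hM0 : 0 ≤ M := (abs_nonneg _).trans (hM 0)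
  rw [norm_mul, Real.norm_eq_abs, Real.norm_of_nonneg (weight_nonneg hx a c), mul_assoc]
  exact mul_le_mul (hM x) (weight_le hx a c) (weight_nonneg hx a c) hM0

theorem PeriodicMeanZero.integrableOn_mul_weight (hP : PeriodicMeanZero P) (a c : ℕ) :
    IntegrableOn (fun x => P x * weight a c x) (Ioi 1) := by
  obtain ⟨M, hM⟩ := hP.bounded
  refine (integrableOn_inv_sq.const_mul (M * (c.factorial / ((a : ℝ) + 1) ^ c))).mono'
    (hP.measurable.mul (measurable_weight a c)).aestronglyMeasurable ?_
  filter_upwards [ae_restrict_mem measurableSet_Ioi] with x hx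
  exact norm_mul_weight_le hM a c (le_of_lt hx)

theorem hasDerivAt_weight (a c : ℕ) {x : ℝ} (hx : 1 ≤ x) :
    HasDerivAt (weight (a + 1) c)
      (((a : ℝ) + 1) * weight a (c + 2) x - ((c : ℝ) + 2) * weight (a + 1) (c + 1) x) x := by
  have hx0 : x ≠ 0 := by positivity
  have hi := hasDerivAt_inv hx0
  refine HasDerivAt.congr_deriv (f := weight (a + 1) c)
    (((hi.const_sub 1).pow (a + 1)).mul (hi.pow (c + 2))) ?_
  simp only [weight, Pi.pow_apply]
  rw [show c + 2 - 1 = c + 1 from rfl, show a + 1 - 1 = a from rfl]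
  push_cast
  simp only [pow_succ]
  field_simp
  ring

/-- The boundary terms vanish: at `1` through the factor `1 - 1/x`, at infinity because `Q` is
bounded and the weight is `O(x⁻²)`. -/
theorem PeriodicMeanZero.exists_integral_by_parts (hP : PeriodicMeanZero P) :
    ∃ Q : ℝ → ℝ, PeriodicMeanZero Q ∧ ∀ a c : ℕ,
      ∫ x in Ioi (1 : ℝ), P x * weight (a + 1) c x =
        ((c : ℝ) + 2) * (∫ x in Ioi (1 : ℝ), Q x * weight (a + 1) (c + 1) x)
          - ((a : ℝ) + 1) * ∫ x in Ioi (1 : ℝ), Q x * weight a (c + 2) x := by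
  obtain ⟨Q, hQ, hQc, hQd⟩ := hP.exists_antideriv
  refine ⟨Q, hQ, fun a c => ?_⟩
  have hI1 := hP.integrableOn_mul_weight (a + 1) c
  have hI2 := (hQ.integrableOn_mul_weight a (c + 2)).const_mul ((a : ℝ) + 1)
  have hI3 := (hQ.integrableOn_mul_weight (a + 1) (c + 1)).const_mul ((c : ℝ) + 2)
  have hI : IntegrableOn (fun x => P x * weight (a + 1) c x
      + (((a : ℝ) + 1) * (Q x * weight a (c + 2) x)
        - ((c : ℝ) + 2) * (Q x * weight (a + 1) (c + 1) x))) (Ioi 1) := hI1.add (hI2.sub hI3)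
  have hlim := intervalIntegral_tendsto_integral_Ioi 1 hI tendsto_id
  have hFTC : ∀ T : ℝ, 1 ≤ T → ∫ x in (1 : ℝ)..T, (P x * weight (a + 1) c x
      + (((a : ℝ) + 1) * (Q x * weight a (c + 2) x)
        - ((c : ℝ) + 2) * (Q x * weight (a + 1) (c + 1) x))) = Q T * weight (a + 1) c T := by
    intro T hT
    rw [integral_eq_of_hasDerivAt_off_countable_of_le (fun x => Q x * weight (a + 1) c x) _ hT
      (countable_range ((↑) : ℤ → ℝ))]
    · simp [weight]
    · intro x hx
      exact (hQc.continuousAt.mul (hasDerivAt_weight a c hx.1).continuousAt).continuousWithinAt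
    · intro x hx
      refine ((hQd x hx.2).mul (hasDerivAt_weight a c hx.1.1.le)).congr_deriv ?_
      ring
    · exact (intervalIntegrable_iff_integrableOn_Ioc_of_le hT).2
        (hI.mono_set Ioc_subset_Ioi_self)
  have hzero : Tendsto (fun T => Q T * weight (a + 1) c T) atTop (𝓝 0) := by
    obtain ⟨M, hM⟩ := hQ.bounded
    refine squeeze_zero_norm' (a := fun x : ℝ =>
      M * (c.factorial / (((a + 1 : ℕ) : ℝ) + 1) ^ c) * x⁻¹ ^ 2) ?_ ?_
    · filter_upwards [eventually_ge_atTop 1] with x hx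
      exact norm_mul_weight_le hM (a + 1) c hx
    · simpa using (tendsto_inv_atTop_zero (𝕜 := ℝ)).pow 2 |>.const_mul
        (M * (c.factorial / (((a + 1 : ℕ) : ℝ) + 1) ^ c))
  have hval := tendsto_nhds_unique hlim (hzero.congr' (by
    filter_upwards [eventually_ge_atTop 1] with T hT
    exact (hFTC T hT).symm))
  have hadd := integral_add hI1 (hI2.sub hI3)
  have hsub := integral_sub hI2 hI3
  simp only [integral_const_mul] at hsub
  simp only [Pi.sub_apply] at hadd
  rw [hsub, hval] at hadd
  linarith

/-- Each integration by parts gains one power of `a + 1`: `c` rises by one, or by two at the cost of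
a factor of order `a`. It may lower `a` by one, hence `K ≤ a`; it changes `P` and `c`, so the
induction quantifies over both. -/
theorem PeriodicMeanZero.exists_integral_bound (K : ℕ) :
    ∀ {P : ℝ → ℝ}, PeriodicMeanZero P → ∀ c : ℕ, ∃ C : ℝ, ∀ a : ℕ, K ≤ a →
      |∫ x in Ioi (1 : ℝ), P x * weight a c x| ≤ C / ((a : ℝ) + 1) ^ (c + K) := by
  induction K with
  | zero =>
    intro P hP c
    obtain ⟨M, hM⟩ := hP.bounded
    refine ⟨M * c.factorial * ∫ x in Ioi (1 : ℝ), x⁻¹ ^ 2, fun a _ => ?_⟩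
    calc |∫ x in Ioi (1 : ℝ), P x * weight a c x|
        ≤ ∫ x in Ioi (1 : ℝ), M * (c.factorial / ((a : ℝ) + 1) ^ c) * x⁻¹ ^ 2 := by
          rw [← Real.norm_eq_abs]
          refine norm_integral_le_of_norm_le (integrableOn_inv_sq.const_mul _) ?_
          filter_upwards [ae_restrict_mem measurableSet_Ioi] with x hx
          exact norm_mul_weight_le hM a c (le_of_lt hx)
      _ = _ := by
          rw [integral_const_mul, add_zero]
          ring
  | succ K ih =>
    intro P hP c
    obtain ⟨Q, hQ, hPQ⟩ := hP.exists_integral_by_parts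
    obtain ⟨C₁, h₁⟩ := ih hQ (c + 1)
    obtain ⟨C₂, h₂⟩ := ih hQ (c + 2)
    -- The power of `2` comes from `a + 2 ≤ 2 (a + 1)`, after `a` is shifted by one.
    refine ⟨((c : ℝ) + 2) * C₁ + 2 ^ (c + K + 1) * C₂, fun a ha => ?_⟩
    obtain ⟨a, rfl⟩ : ∃ a', a = a' + 1 := ⟨a - 1, by omega⟩
    have h1 := h₁ (a + 1) (by omega)
    have h2 := h₂ a (by omega)
    have hC₂ : 0 ≤ C₂ := by
      have := (abs_nonneg _).trans h2
      by_contra! h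
      exact absurd this (not_le.2 (div_neg_of_neg_of_pos h (by positivity)))
    rw [hPQ]
    have h3 : ((a : ℝ) + 1) * (C₂ / ((a : ℝ) + 1) ^ (c + 2 + K)) ≤
        2 ^ (c + K + 1) * C₂ / (((a + 1 : ℕ) : ℝ) + 1) ^ (c + (K + 1)) := by
      have e : ((a : ℝ) + 1) * (C₂ / ((a : ℝ) + 1) ^ (c + 2 + K)) =
          C₂ / ((a : ℝ) + 1) ^ (c + K + 1) := by
        rw [show c + 2 + K = c + K + 1 + 1 by ring, pow_succ _ (c + K + 1)]
        field_simp
      rw [e, div_le_div_iff₀ (by positivity) (by positivity), ← add_assoc, mul_comm (2 ^ _) C₂,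
        mul_assoc, ← mul_pow]
      refine mul_le_mul_of_nonneg_left (pow_le_pow_left₀ (by positivity) ?_ _) hC₂
      push_cast
      linarith [Nat.cast_nonneg (α := ℝ) a]
    calc _ ≤ |((c : ℝ) + 2) * ∫ x in Ioi (1 : ℝ), Q x * weight (a + 1) (c + 1) x|
          + |((a : ℝ) + 1) * ∫ x in Ioi (1 : ℝ), Q x * weight a (c + 2) x| := abs_sub _ _
      _ ≤ ((c : ℝ) + 2) * (C₁ / (((a + 1 : ℕ) : ℝ) + 1) ^ (c + 1 + K))
          + ((a : ℝ) + 1) * (C₂ / ((a : ℝ) + 1) ^ (c + 2 + K)) := by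
          rw [abs_mul, abs_mul, abs_of_nonneg (show (0 : ℝ) ≤ c + 2 by positivity),
            abs_of_nonneg (show (0 : ℝ) ≤ a + 1 by positivity)]
          gcongr
      _ ≤ _ := by
          rw [add_div, show c + 1 + K = c + (K + 1) by ring, mul_div_assoc]
          exact add_le_add_right h3 _

/-! ### The sawtooth integral for `Z` on the real half-line `s ≥ 1` -/

/-- The sawtooth `{x} - 1/2`. -/
noncomputable def sawtooth (x : ℝ) : ℝ := Int.fract x - 1 / 2

theorem measurable_sawtooth : Measurable sawtooth := measurable_fract.sub_const _

theorem abs_sawtooth_le (x : ℝ) : |sawtooth x| ≤ 1 := by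
  have h0 := Int.fract_nonneg x
  have h1 := Int.fract_lt_one x
  rw [sawtooth, abs_le]
  constructor <;> linarith

theorem periodicMeanZero_sawtooth : PeriodicMeanZero sawtooth where
  measurable := measurable_sawtooth
  periodic x := by simp [sawtooth]
  mean := by
    have : ∫ x in (0 : ℝ)..1, sawtooth x = ∫ x in (0 : ℝ)..1, (x - 1 / 2) := by
      rw [intervalIntegral.integral_of_le zero_le_one, intervalIntegral.integral_of_le zero_le_one,
        integral_Ioc_eq_integral_Ioo, integral_Ioc_eq_integral_Ioo]
      refine setIntegral_congr_fun measurableSet_Ioo fun x hx => ?_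
      simp only [sawtooth]
      rw [Int.fract_eq_self.2 ⟨hx.1.le, hx.2⟩]
    rw [this, intervalIntegral.integral_sub (by simp) (by simp)]
    simp
  bounded := ⟨1, abs_sawtooth_le⟩
  continuousAt x hx := by
    refine ContinuousAt.sub ?_ continuousAt_const
    refine continuousAt_fract fun h => hx ⟨⌊x⌋, ?_⟩
    simpa using h.symm

theorem integrableOn_rpow {s : ℝ} (hs : 0 < s) :
    IntegrableOn (fun x : ℝ => x ^ (-(s + 1))) (Ioi 1) :=
  integrableOn_Ioi_rpow_of_lt (by linarith) one_pos

theorem integrableOn_mul_rpow {f : ℝ → ℝ} (hf : Measurable f) (hb : ∀ x, |f x| ≤ 1) {s : ℝ}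
    (hs : 0 < s) : IntegrableOn (fun x : ℝ => f x * x ^ (-(s + 1))) (Ioi 1) := by
  refine (integrableOn_rpow hs).mono'
    (hf.mul (measurable_id.pow_const (-(s + 1)))).aestronglyMeasurable ?_
  filter_upwards [ae_restrict_mem measurableSet_Ioi] with x hx
  have hx0 : 0 ≤ x ^ (-(s + 1)) := Real.rpow_nonneg (zero_le_one.trans (le_of_lt hx)) _
  rw [norm_mul, Real.norm_of_nonneg hx0]
  exact mul_le_of_le_one_left hx0 (hb x)

theorem abs_fract_le_one (x : ℝ) : |Int.fract x| ≤ 1 := by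
  rw [abs_of_nonneg (Int.fract_nonneg x)]
  exact (Int.fract_lt_one x).le

theorem term_eq_integral_fract (n : ℕ) (s : ℝ) :
    ZetaAsymptotics.term (n + 1) s =
      ∫ x in ((n : ℝ) + 1)..(((n + 1 : ℕ) : ℝ) + 1), Int.fract x * x ^ (-(s + 1)) := by
  rw [ZetaAsymptotics.term]
  push_cast
  rw [intervalIntegral.integral_of_le (by linarith), intervalIntegral.integral_of_le (by linarith),
    integral_Ioc_eq_integral_Ioo, integral_Ioc_eq_integral_Ioo]
  refine setIntegral_congr_fun measurableSet_Ioo fun x hx => ?_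
  have hx0 : 0 ≤ x := by linarith [hx.1, Nat.cast_nonneg (α := ℝ) n]
  have hfl : ⌊x⌋ = (n : ℤ) + 1 := by
    rw [Int.floor_eq_iff]
    push_cast
    exact ⟨hx.1.le, hx.2⟩
  rw [Real.rpow_neg hx0, div_eq_mul_inv, Int.fract, hfl]
  push_cast
  rfl

theorem termTSum_eq_integral {s : ℝ} (hs : 0 < s) :
    ZetaAsymptotics.termTSum s = ∫ x in Ioi (1 : ℝ), Int.fract x * x ^ (-(s + 1)) := by
  have hint := integrableOn_mul_rpow measurable_fract abs_fract_le_one hs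
  refine HasSum.tsum_eq ?_
  rw [hasSum_iff_tendsto_nat_of_nonneg fun n => ZetaAsymptotics.term_nonneg (n + 1) s]
  have hT : Tendsto (fun N : ℕ => (N : ℝ) + 1) atTop atTop :=
    tendsto_atTop_add_const_right _ _ tendsto_natCast_atTop_atTop
  refine (intervalIntegral_tendsto_integral_Ioi 1 hint hT).congr fun N => ?_
  simp only [term_eq_integral_fract]
  rw [intervalIntegral.sum_integral_adjacent_intervals
    (a := fun n : ℕ => (n : ℝ) + 1) (fun k _ => ?_)]
  · simp
  · refine (intervalIntegrable_iff_integrableOn_Ioc_of_le (by push_cast; linarith)).2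
      (hint.mono_set fun x hx => ?_)
    exact lt_of_le_of_lt (by linarith [Nat.cast_nonneg (α := ℝ) k]) hx.1

theorem integral_sawtooth_mul_rpow {s : ℝ} (hs : 0 < s) :
    ∫ x in Ioi (1 : ℝ), sawtooth x * x ^ (-(s + 1)) =
      ZetaAsymptotics.termTSum s - 1 / (2 * s) := by
  have h := integral_sub (integrableOn_mul_rpow measurable_fract abs_fract_le_one hs)
    ((integrableOn_rpow hs).const_mul (1 / 2))
  rw [integral_const_mul, integral_Ioi_rpow_of_lt (by linarith) one_pos, Real.one_rpow,
    ← termTSum_eq_integral hs] at h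
  simp only [← sub_mul] at h
  simp only [sawtooth]
  rw [h]
  congr 1
  rw [show -(s + 1) + 1 = -s by ring]
  field_simp

theorem Z_ofReal {s : ℝ} (hs : 1 ≤ s) :
    Z s = ((1 / 2 - s * ∫ x in Ioi (1 : ℝ), sawtooth x * x ^ (-(s + 1)) : ℝ) : ℂ) := by
  have hs0 : 0 < s := by linarith
  rw [integral_sawtooth_mul_rpow hs0, mul_sub, show s * (1 / (2 * s)) = 1 / 2 by field_simp,
    show ∀ t : ℝ, 1 / 2 - (t - 1 / 2) = 1 - t by intro t; ring]
  rcases hs.eq_or_lt with rfl | hs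
  · have := ZetaAsymptotics.term_tsum_one.tsum_eq
    rw [ZetaAsymptotics.termTSum, this]
    simp [Z]
  · rw [← ZetaAsymptotics.zeta_limit_aux1 hs, Z, if_neg (by exact_mod_cast hs.ne'),
      zeta_eq_tsum_one_div_nat_add_one_cpow (by simpa using hs)]
    push_cast
    congr 2
    ext n
    rw [Complex.ofReal_cpow (by positivity)]
    push_cast
    rfl

theorem weight_zero_left_eq_rpow (j : ℕ) {x : ℝ} (hx : 0 < x) :
    weight 0 j x = x ^ (-(((j : ℝ) + 1) + 1)) := by
  rw [weight, pow_zero, one_mul, Real.rpow_neg hx.le, inv_pow]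
  congr 1
  rw [← Real.rpow_natCast]
  push_cast
  congr 1
  ring

theorem Z_natCast_succ (j : ℕ) :
    Z ((j + 1 : ℕ) : ℂ) =
      ((1 / 2 - ((j : ℝ) + 1) * ∫ x in Ioi (1 : ℝ), sawtooth x * weight 0 j x : ℝ) : ℂ) := by
  have h := Z_ofReal (s := (j : ℝ) + 1) (by linarith [Nat.cast_nonneg (α := ℝ) j])
  rw [setIntegral_congr_fun measurableSet_Ioi fun x hx => by
    rw [weight_zero_left_eq_rpow j (one_pos.trans hx)]]
  rw [← h]
  push_cast
  rfl

theorem Z_zero : Z 0 = 1 / 2 := by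
  rw [Z, if_neg (by norm_num), riemannZeta_zero]
  norm_num

/-! ### The coefficients as finite differences and as integrals -/

theorem sum_neg_one_pow_choose_succ (n : ℕ) :
    ∑ i ∈ Finset.range (n + 1), ((-1) ^ i * ((n + 1).choose (i + 1)) : ℚ) = 1 := by
  have h := Int.alternating_sum_range_choose (n := n + 1)
  rw [if_neg (by omega), Finset.sum_range_succ'] at h
  have h2 : ∑ i ∈ Finset.range (n + 1), ((-1) ^ i * ((n + 1).choose (i + 1)) : ℤ) = 1 := by
    simp only [pow_succ, mul_neg, mul_one, neg_mul, Finset.sum_neg_distrib, pow_zero,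
      Nat.choose_zero_right, Nat.cast_one] at h
    linarith
  exact_mod_cast h2

theorem sum_choose_div_eq_harmonic (n : ℕ) :
    ∑ i ∈ Finset.range n, ((-1) ^ i * (n.choose (i + 1)) / (i + 1) : ℚ) = harmonic n := by
  induction n with
  | zero => simp
  | succ n ih =>
    have hlast : ∑ i ∈ Finset.range (n + 1), ((-1) ^ i * (n.choose (i + 1)) / (i + 1) : ℚ)
        = harmonic n := by
      rw [Finset.sum_range_succ, ih]
      simp
    have hfirst : ∑ i ∈ Finset.range (n + 1), ((-1) ^ i * (n.choose i) / (i + 1) : ℚ)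
        = (n + 1 : ℚ)⁻¹ := by
      rw [← one_div, eq_div_iff (by positivity), Finset.sum_mul]
      refine Eq.trans ?_ (sum_neg_one_pow_choose_succ n)
      refine Finset.sum_congr rfl fun i _ => ?_
      have h : ((n : ℚ) + 1) * n.choose i = (n + 1).choose (i + 1) * (i + 1) := by
        exact_mod_cast Nat.add_one_mul_choose_eq n i
      field_simp
      linear_combination h
    rw [harmonic_succ, ← hlast, add_comm (Finset.sum _ _)]
    push_cast
    rw [← hfirst, ← Finset.sum_add_distrib]
    refine Finset.sum_congr rfl fun i _ => ?_
    rw [Nat.choose_succ_succ]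
    push_cast
    ring

/-- Evaluates what the terms `1/(k-1)`, `k = i + 2`, of `Z(k)` contribute to the alternating sum;
this is the source of the harmonic number in `b`. -/
theorem sum_choose_add_two_div (m : ℕ) :
    ∑ i ∈ Finset.range m, ((-1) ^ i * ((m + 1).choose (i + 2)) / (i + 1) : ℚ) =
      1 - (m + 1) * (1 - harmonic m) := by
  induction m with
  | zero => simp
  | succ m ih =>
    have hlast : ∑ i ∈ Finset.range (m + 1), ((-1) ^ i * ((m + 1).choose (i + 2)) / (i + 1) : ℚ)
        = 1 - (m + 1) * (1 - harmonic m) := by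
      rw [Finset.sum_range_succ, ih]
      simp
    have hfirst := sum_choose_div_eq_harmonic (m + 1)
    have hsplit : ∑ i ∈ Finset.range (m + 1),
        ((-1) ^ i * ((m + 1 + 1).choose (i + 2)) / (i + 1) : ℚ) =
        harmonic (m + 1) + (1 - (m + 1) * (1 - harmonic m)) := by
      rw [← hfirst, ← hlast, ← Finset.sum_add_distrib]
      refine Finset.sum_congr rfl fun i _ => ?_
      rw [Nat.choose_succ_succ (m + 1)]
      push_cast
      ring
    rw [hsplit, harmonic_succ]
    push_cast
    field_simp
    ring

theorem b_eq_sum_Z (m : ℕ) :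
    b (m + 1) = ∑ k ∈ Finset.range (m + 2), (-1) ^ k * ((m + 1).choose k : ℂ) * Z k := by
  rw [Finset.sum_range_succ', Finset.sum_range_succ']
  have hS : ∑ i ∈ Finset.range m, ((-1) ^ i * ((m + 1).choose (i + 2)) / (i + 1) : ℂ) =
      1 - (m + 1) * (1 - ((harmonic m : ℚ) : ℂ)) := by
    have := congrArg (fun q : ℚ => (q : ℂ)) (sum_choose_add_two_div m)
    push_cast at this
    exact this
  have hIcc : ∑ k ∈ Finset.Icc 2 (m + 1),
        ((m + 1).choose k : ℂ) * (-1) ^ k * riemannZeta (k : ℂ) =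
      ∑ i ∈ Finset.range m,
        ((m + 1).choose (i + 2) : ℂ) * (-1) ^ (i + 2) * riemannZeta ((i + 2 : ℕ) : ℂ) := by
    rw [← Finset.Ico_add_one_right_eq_Icc, Finset.sum_Ico_eq_sum_range]
    refine Finset.sum_congr (by congr 1) fun i _ => ?_
    rw [add_comm 2 i]
  have hZ : ∀ i ∈ Finset.range m,
      (-1 : ℂ) ^ (i + 1 + 1) * ((m + 1).choose (i + 1 + 1) : ℂ) * Z ((i + 1 + 1 : ℕ) : ℂ) =
      ((m + 1).choose (i + 2) : ℂ) * (-1) ^ (i + 2) * riemannZeta ((i + 2 : ℕ) : ℂ)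
        - (-1) ^ i * ((m + 1).choose (i + 2)) / (i + 1) := by
    intro i _
    have h1 : ((i + 1 + 1 : ℕ) : ℂ) ≠ 1 := by
      norm_cast
      omega
    rw [Z, if_neg h1, show ((i + 1 + 1 : ℕ) : ℂ) - 1 = i + 1 by push_cast; ring]
    ring
  rw [Finset.sum_congr rfl hZ, Finset.sum_sub_distrib, hS, ← hIcc, b]
  have hZ1 : Z ((0 + 1 : ℕ) : ℂ) = (Real.eulerMascheroniConstant : ℂ) := by simp [Z]
  rw [hZ1, Nat.cast_zero, Z_zero]
  simp
  ring

theorem weight_zero_right_eq_sum (m : ℕ) (x : ℝ) :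
    weight m 0 x = ∑ j ∈ Finset.range (m + 1), (-1) ^ j * (m.choose j : ℝ) * weight 0 j x := by
  simp only [weight, pow_zero, one_mul, zero_add]
  rw [sub_eq_neg_add, add_pow, Finset.sum_mul]
  refine Finset.sum_congr rfl fun j _ => ?_
  rw [neg_pow, one_pow]
  ring

/-- The identity `(j+1) C(m+1,j+1) = (m+1) C(m,j)` turns the alternating sum into the expansion of
`(1 - 1/x)^m`; the constants `1/2` cancel. -/
theorem b_succ (m : ℕ) :
    b (m + 1) = (((m : ℝ) + 1) * ∫ x in Ioi (1 : ℝ), sawtooth x * weight m 0 x : ℝ) := by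
  set I : ℕ → ℝ := fun j => ∫ x in Ioi (1 : ℝ), sawtooth x * weight 0 j x with hI
  have hint : ∫ x in Ioi (1 : ℝ), sawtooth x * weight m 0 x =
      ∑ j ∈ Finset.range (m + 1), (-1) ^ j * (m.choose j : ℝ) * I j := by
    simp only [hI, weight_zero_right_eq_sum m, Finset.mul_sum]
    rw [integral_finsetSum]
    · refine Finset.sum_congr rfl fun j _ => ?_
      rw [← integral_const_mul]
      congr 1 with x
      ring
    · intro j _
      refine ((periodicMeanZero_sawtooth.integrableOn_mul_weight 0 j).const_mul
        ((-1) ^ j * (m.choose j : ℝ))).congr (Eventually.of_forall fun x => ?_)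
      simp only
      ring
  have halt : ∑ j ∈ Finset.range (m + 1), ((-1 : ℂ) ^ j * ((m + 1).choose (j + 1) : ℂ)) = 1 := by
    exact_mod_cast congrArg (fun q : ℚ => (q : ℂ)) (sum_neg_one_pow_choose_succ m)
  rw [b_eq_sum_Z, Finset.sum_range_succ', hint, Nat.cast_zero, Z_zero]
  have hterm : ∀ j ∈ Finset.range (m + 1),
      (-1 : ℂ) ^ (j + 1) * ((m + 1).choose (j + 1) : ℂ) * Z ((j + 1 : ℕ) : ℂ) =
      ((m : ℂ) + 1) * ((-1) ^ j * (m.choose j : ℂ) * (I j : ℂ))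
        - 1 / 2 * ((-1 : ℂ) ^ j * ((m + 1).choose (j + 1) : ℂ)) := by
    intro j _
    have h : ((m : ℂ) + 1) * m.choose j = (m + 1).choose (j + 1) * (j + 1) := by
      exact_mod_cast Nat.add_one_mul_choose_eq m j
    rw [Z_natCast_succ]
    push_cast
    linear_combination -((-1) ^ j * (I j : ℂ)) * h
  rw [Finset.sum_congr rfl hterm, Finset.sum_sub_distrib, ← Finset.mul_sum, ← Finset.mul_sum, halt]
  push_cast
  simp

theorem b_isBigO (K : ℕ) : b =O[atTop] fun n : ℕ => (((n : ℝ) + 1) ^ K)⁻¹ := by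
  -- One extra power pays for the factor `m + 1` in `b_succ`.
  obtain ⟨C, hC⟩ := PeriodicMeanZero.exists_integral_bound (K + 1) periodicMeanZero_sawtooth 0
  refine Asymptotics.IsBigO.of_bound (2 ^ K * |C|) ?_
  filter_upwards [eventually_ge_atTop (K + 2)] with n hn
  obtain ⟨m, rfl⟩ : ∃ m, n = m + 1 := ⟨n - 1, by omega⟩
  have h := hC m (by omega)
  have hm : (0 : ℝ) < (m : ℝ) + 1 := by positivity
  rw [b_succ, Complex.norm_real, norm_mul, Real.norm_of_nonneg hm.le, Real.norm_eq_abs,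
    Real.norm_of_nonneg (by positivity)]
  calc ((m : ℝ) + 1) * |∫ x in Ioi (1 : ℝ), sawtooth x * weight m 0 x|
      ≤ ((m : ℝ) + 1) * (|C| / ((m : ℝ) + 1) ^ (0 + (K + 1))) := by
        refine mul_le_mul_of_nonneg_left (h.trans ?_) hm.le
        gcongr
        exact le_abs_self C
    _ = |C| / ((m : ℝ) + 1) ^ K := by
        rw [zero_add, pow_succ]
        field_simp
    _ ≤ 2 ^ K * |C| * (((((m + 1 : ℕ) : ℝ)) + 1) ^ K)⁻¹ := by
        rw [← div_eq_mul_inv, div_le_div_iff₀ (by positivity) (by positivity),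
          mul_comm (2 ^ K) |C|, mul_assoc, ← mul_pow]
        refine mul_le_mul_of_nonneg_left (pow_le_pow_left₀ (by positivity) ?_ _) (abs_nonneg C)
        push_cast
        linarith [Nat.cast_nonneg (α := ℝ) m]

theorem exists_norm_b_le (K : ℕ) : ∃ C : ℝ, ∀ n, ‖b n‖ ≤ C * (((n : ℝ) + 1) ^ K)⁻¹ := by
  obtain ⟨C, _, hC⟩ := Asymptotics.bound_of_isBigO_nat_atTop (b_isBigO K)
  refine ⟨C, fun n => ?_⟩
  have hpos : (0 : ℝ) < (((n : ℝ) + 1) ^ K)⁻¹ := by positivity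
  simpa only [Real.norm_of_nonneg hpos.le] using hC hpos.ne'

/-! ### Growth of binomial coefficients and analyticity -/

theorem choose_succ_eq {F : Type*} [Field F] [CharZero F] (s : F) (n : ℕ) :
    Ring.choose s (n + 1) = Ring.choose s n * (s - n) / (n + 1) := by
  have h := Ring.choose_smul_choose s (Nat.le_succ n)
  rw [Nat.succ_eq_add_one, Nat.add_sub_cancel_left, Ring.choose_one_right,
    Nat.choose_succ_self_right, nsmul_eq_mul] at h
  have hn : (n : F) + 1 ≠ 0 := Nat.cast_add_one_ne_zero n
  rw [eq_div_iff hn, ← h]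
  push_cast
  ring

theorem succ_mul_choose_succ {F : Type*} [Field F] [CharZero F] (s : F) (n : ℕ) :
    ((n : F) + 1) * Ring.choose s (n + 1) = s * Ring.choose (s - 1) n := by
  have h := Ring.choose_add_smul_choose (s - 1) n 1
  rw [Nat.cast_one, sub_add_cancel, Ring.choose_one_right, Nat.choose_one_right,
    nsmul_eq_mul] at h
  push_cast at h
  exact h

/-- Each new factor is at most `(R + n)/(n + 1) ≤ (1 + 1/(n+1))^R` by Bernoulli, and this product
telescopes. -/
theorem norm_choose_le (R : ℕ) {s : ℂ} (hs : ‖s‖ ≤ R) (n : ℕ) :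
    ‖Ring.choose s n‖ ≤ ((n : ℝ) + 1) ^ R := by
  induction n with
  | zero => simp
  | succ n ih =>
    have hn : (0 : ℝ) < (n : ℝ) + 1 := by positivity
    have hn1 : ‖(n : ℂ) + 1‖ = (n : ℝ) + 1 := by
      rw [← Nat.cast_add_one, Complex.norm_natCast]
      push_cast
      rfl
    have hsn : ‖s - n‖ ≤ R + n := (norm_sub_le _ _).trans (by simpa using hs)
    rw [choose_succ_eq, norm_div, norm_mul, hn1, mul_div_assoc]
    have hB : ((R : ℝ) + n) / (n + 1) ≤ (1 + 1 / ((n : ℝ) + 1)) ^ R := by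
      refine le_trans ?_ (one_add_mul_le_pow (by
        have : 0 ≤ 1 / ((n : ℝ) + 1) := by positivity
        linarith) R)
      rw [div_le_iff₀ hn]
      field_simp
      linarith
    calc ‖Ring.choose s n‖ * (‖s - n‖ / (n + 1))
        ≤ ((n : ℝ) + 1) ^ R * (1 + 1 / ((n : ℝ) + 1)) ^ R :=
          mul_le_mul ih ((div_le_div_of_nonneg_right hsn hn.le).trans hB) (by positivity)
            (by positivity)
      _ = (((n + 1 : ℕ) : ℝ) + 1) ^ R := by
          rw [← mul_pow]
          congr 1
          push_cast
          field_simp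

theorem differentiable_choose (n : ℕ) : Differentiable ℂ fun s : ℂ => Ring.choose s n := by
  induction n with
  | zero => simp
  | succ n ih =>
    simp only [choose_succ_eq]
    fun_prop

theorem exists_summable_bound (R : ℕ) : ∃ u : ℕ → ℝ, Summable u ∧ ∀ (n : ℕ) (s : ℂ),
    s ∈ Metric.ball (0 : ℂ) R → ‖(-1 : ℂ) ^ n * b n * Ring.choose s n‖ ≤ u n := by
  obtain ⟨C, hC⟩ := exists_norm_b_le (R + 2)
  refine ⟨fun n => C * (((n : ℝ) + 1) ^ 2)⁻¹, ?_, fun n s hs => ?_⟩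
  · have := (summable_nat_add_iff 1).2 (Real.summable_nat_pow_inv.2 (show 1 < 2 by norm_num))
    push_cast at this
    exact this.mul_left C
  · have hs' : ‖s‖ ≤ R := (mem_ball_zero_iff.1 hs).le
    have hn : (0 : ℝ) < (n : ℝ) + 1 := by positivity
    rw [norm_mul, norm_mul, norm_pow, norm_neg, norm_one, one_pow, one_mul]
    calc ‖b n‖ * ‖Ring.choose s n‖
        ≤ C * (((n : ℝ) + 1) ^ (R + 2))⁻¹ * ((n : ℝ) + 1) ^ R :=
          mul_le_mul (hC n) (norm_choose_le R hs' n) (norm_nonneg _)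
            ((norm_nonneg _).trans (hC n))
      _ = C * (((n : ℝ) + 1) ^ 2)⁻¹ := by
          rw [pow_add]
          field_simp

theorem exists_mem_ball_natCast (s : ℂ) : ∃ R : ℕ, s ∈ Metric.ball (0 : ℂ) R := by
  obtain ⟨R, hR⟩ := exists_nat_gt ‖s‖
  exact ⟨R, mem_ball_zero_iff.2 hR⟩

theorem summable_newton (s : ℂ) :
    Summable fun n : ℕ => (-1 : ℂ) ^ n * b n * Ring.choose s n := by
  obtain ⟨R, hR⟩ := exists_mem_ball_natCast s
  obtain ⟨u, hu, hle⟩ := exists_summable_bound R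
  exact Summable.of_norm_bounded hu fun n => hle n s hR

theorem differentiable_newton :
    Differentiable ℂ fun s : ℂ => ∑' n : ℕ, (-1 : ℂ) ^ n * b n * Ring.choose s n := by
  intro s
  obtain ⟨R, hR⟩ := exists_mem_ball_natCast s
  obtain ⟨u, hu, hle⟩ := exists_summable_bound R
  exact (Complex.differentiableOn_tsum_of_summable_norm hu
    (fun n => ((differentiable_choose n).const_mul _).differentiableOn) Metric.isOpen_ball
    hle).differentiableAt (Metric.isOpen_ball.mem_nhds hR)

theorem differentiable_Z : Differentiable ℂ Z := by
  have hne : ∀ s : ℂ, s ≠ 1 → DifferentiableAt ℂ Z s := by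
    intro s hs
    have h : DifferentiableAt ℂ (fun s : ℂ => riemannZeta s - 1 / (s - 1)) s :=
      (differentiableAt_riemannZeta hs).sub
        ((differentiableAt_const _).div (by fun_prop) (sub_ne_zero.2 hs))
    refine h.congr_of_eventuallyEq ?_
    filter_upwards [isOpen_ne.mem_nhds hs] with t ht
    rw [Z, if_neg ht]
  intro s
  by_cases hs : s = 1
  · subst hs
    refine (Complex.analyticAt_of_differentiable_on_punctured_nhds_of_continuousAt
      (eventually_nhdsWithin_of_forall fun t ht => hne t ht) ?_).differentiableAt
    rw [continuousAt_iff_punctured_nhds]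
    have h1 : Z 1 = (Real.eulerMascheroniConstant : ℂ) := by simp [Z]
    rw [h1]
    refine tendsto_riemannZeta_sub_one_div.congr' ?_
    filter_upwards [self_mem_nhdsWithin] with t ht
    rw [Z, if_neg (show t ≠ 1 from ht)]
  · exact hne s hs

/-! ### The identity on `[1,2]` and its continuation -/

theorem hasSum_binomial (α : ℝ) {u : ℝ} (h0 : 0 ≤ u) (h1 : u < 1) :
    HasSum (fun m : ℕ => (-1) ^ m * Ring.choose α m * u ^ m) ((1 - u) ^ α) := by
  have h := (Real.one_add_rpow_hasFPowerSeriesOnBall_zero (a := α)).hasSum (y := -u) (by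
    simpa [Metric.mem_eball, edist_dist, abs_of_nonneg h0] using h1)
  simp only [zero_add] at h
  rw [← sub_eq_add_neg] at h
  refine h.congr_fun fun m => ?_
  simp [binomialSeries, FormalMultilinearSeries.coeff_ofScalars, neg_pow u]
  ring

theorem neg_one_pow_mul_choose_nonpos {α : ℝ} (h0 : 0 ≤ α) (h1 : α ≤ 1) (m : ℕ) :
    (-1) ^ (m + 1) * Ring.choose α (m + 1) ≤ 0 := by
  induction m with
  | zero => simpa [Ring.choose_one_right] using h0
  | succ m ih =>
    rw [choose_succ_eq, show (-1 : ℝ) ^ (m + 1 + 1) *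
        (Ring.choose α (m + 1) * (α - (m + 1 : ℕ)) / ((m + 1 : ℕ) + 1)) =
      (-1) ^ (m + 1) * Ring.choose α (m + 1) * (((m + 1 : ℕ) - α) / ((m + 1 : ℕ) + 1)) by ring]
    refine mul_nonpos_of_nonpos_of_nonneg ih (div_nonneg ?_ (by positivity))
    push_cast
    linarith [Nat.cast_nonneg (α := ℝ) m]

/-- For `0 ≤ α ≤ 1` all terms after the zeroth are nonpositive, so taking absolute values flips them
and leaves the leading `1`. The closed form supplies the integrable majorant for
`hasSum_integral_sawtooth`. -/
theorem hasSum_abs_binomial {α : ℝ} (hα0 : 0 ≤ α) (hα1 : α ≤ 1) {u : ℝ} (h0 : 0 ≤ u)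
    (h1 : u < 1) :
    HasSum (fun m : ℕ => |(-1) ^ m * Ring.choose α m| * u ^ m) (2 - (1 - u) ^ α) := by
  refine ((hasSum_ite_eq 0 (2 : ℝ)).sub (hasSum_binomial α h0 h1)).congr_fun fun m => ?_
  cases m with
  | zero => norm_num [Ring.choose_zero_right]
  | succ m =>
    rw [abs_of_nonpos (neg_one_pow_mul_choose_nonpos hα0 hα1 m)]
    simp

theorem hasSum_integral_sawtooth {α : ℝ} (h0 : 0 ≤ α) (h1 : α ≤ 1) :
    HasSum (fun m : ℕ => (-1) ^ m * Ring.choose α m *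
        ∫ x in Ioi (1 : ℝ), sawtooth x * weight m 0 x)
      (∫ x in Ioi (1 : ℝ), sawtooth x * x ^ (-((1 + α) + 1))) := by
  have hu : ∀ x ∈ Ioi (1 : ℝ), 0 ≤ 1 - x⁻¹ ∧ 1 - x⁻¹ < 1 := fun x hx =>
    ⟨sub_nonneg.2 (inv_le_one_of_one_le₀ (le_of_lt hx)),
      sub_lt_self _ (inv_pos.2 (one_pos.trans hx))⟩
  have habs : ∀ x ∈ Ioi (1 : ℝ),
      HasSum (fun m : ℕ => |(-1) ^ m * Ring.choose α m| * weight m 0 x)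
        ((2 - x⁻¹ ^ α) * x⁻¹ ^ 2) := fun x hx => by
    have := (hasSum_abs_binomial h0 h1 (hu x hx).1 (hu x hx).2).mul_right (x⁻¹ ^ 2)
    rw [sub_sub_cancel] at this
    simpa only [weight, zero_add, mul_assoc] using this
  simp only [← integral_const_mul]
  refine hasSum_integral_of_dominated_convergence
    (fun m x => |(-1) ^ m * Ring.choose α m| * weight m 0 x) (fun m => ?_) (fun m => ?_) ?_ ?_ ?_
  · exact (measurable_const.mul
      (measurable_sawtooth.mul (measurable_weight m 0))).aestronglyMeasurable
  · filter_upwards [ae_restrict_mem measurableSet_Ioi] with x hx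
    have hw := weight_nonneg (le_of_lt hx) m 0
    rw [norm_mul, norm_mul (sawtooth x), Real.norm_of_nonneg hw, Real.norm_eq_abs, Real.norm_eq_abs]
    exact mul_le_mul_of_nonneg_left (mul_le_of_le_one_left hw (abs_sawtooth_le x)) (abs_nonneg _)
  · filter_upwards [ae_restrict_mem measurableSet_Ioi] with x hx
    exact (habs x hx).summable
  · have hmaj : IntegrableOn (fun x : ℝ => (2 - x⁻¹ ^ α) * x⁻¹ ^ 2) (Ioi 1) := by
      refine (integrableOn_inv_sq.const_mul 2).mono' ?_ ?_
      · exact ((measurable_const.sub (measurable_inv.pow_const α)).mul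
          (measurable_inv.pow_const 2)).aestronglyMeasurable
      · filter_upwards [ae_restrict_mem measurableSet_Ioi] with x hx
        have hx0 : 0 ≤ x⁻¹ := (inv_pos.2 (one_pos.trans hx)).le
        have hp := Real.rpow_nonneg hx0 α
        have hp1 := Real.rpow_le_one hx0 (inv_le_one_of_one_le₀ (le_of_lt hx)) h0
        rw [Real.norm_of_nonneg (mul_nonneg (by linarith) (by positivity))]
        exact mul_le_mul_of_nonneg_right (by linarith) (by positivity)
    exact hmaj.congr_fun (fun x hx => (habs x hx).tsum_eq.symm) measurableSet_Ioi
  · filter_upwards [ae_restrict_mem measurableSet_Ioi] with x hx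
    have hx0 : (0 : ℝ) < x := one_pos.trans hx
    have h := ((hasSum_binomial α (hu x hx).1 (hu x hx).2).mul_right (x⁻¹ ^ 2)).mul_left
      (sawtooth x)
    have hpow : x ^ (-((1 + α) + 1)) = (1 - (1 - x⁻¹)) ^ α * x⁻¹ ^ 2 := by
      rw [sub_sub_cancel, Real.inv_rpow hx0.le, inv_pow, ← mul_inv, ← Real.rpow_natCast,
        ← Real.rpow_add hx0, Real.rpow_neg hx0.le]
      push_cast
      congr 2
      ring
    rw [hpow]
    refine h.congr_fun fun m => ?_
    simp only [weight, zero_add]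
    ring

theorem hasSum_newton_of_mem_Icc {s : ℝ} (hs : s ∈ Icc (1 : ℝ) 2) :
    HasSum (fun n : ℕ => (-1 : ℂ) ^ n * b n * Ring.choose (s : ℂ) n) (Z s) := by
  have h := hasSum_integral_sawtooth (α := s - 1) (by linarith [hs.1]) (by linarith [hs.2])
  rw [add_sub_cancel] at h
  have h2 := Complex.hasSum_ofReal.2 (h.mul_left (-s))
  -- The term `n = 0` is the constant `1/2` of the integral formula.
  rw [← hasSum_nat_add_iff' 1, Z_ofReal hs.1]
  have hval : ((1 / 2 - s * ∫ x in Ioi (1 : ℝ), sawtooth x * x ^ (-(s + 1)) : ℝ) : ℂ) -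
      ∑ n ∈ Finset.range 1, (-1 : ℂ) ^ n * b n * Ring.choose (s : ℂ) n =
      ((-s * ∫ x in Ioi (1 : ℝ), sawtooth x * x ^ (-(s + 1)) : ℝ) : ℂ) := by
    simp [b]
  rw [hval]
  refine h2.congr_fun fun m => ?_
  have hc := succ_mul_choose_succ (s : ℂ) m
  rw [b_succ]
  push_cast [Complex.ofReal_choose]
  rw [pow_succ]
  linear_combination
    -((-1 : ℂ) ^ m * ((∫ x in Ioi (1 : ℝ), sawtooth x * weight m 0 x : ℝ) : ℂ)) * hc

theorem tsum_newton_eq_Z :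
    (fun s : ℂ => ∑' n : ℕ, (-1 : ℂ) ^ n * b n * Ring.choose s n) = Z := by
  refine AnalyticOnNhd.eq_of_frequently_eq (𝕜 := ℂ) (z₀ := ((3 / 2 : ℝ) : ℂ))
    (fun s _ => differentiable_newton.analyticAt s) (fun s _ => differentiable_Z.analyticAt s) ?_
  have hreal : ∃ᶠ t : ℝ in 𝓝[≠] (3 / 2 : ℝ), t ∈ Icc (1 : ℝ) 2 :=
    (eventually_nhdsWithin_of_eventually_nhds
      (Icc_mem_nhds (by norm_num) (by norm_num))).frequently
  have hmap : Tendsto ((↑) : ℝ → ℂ) (𝓝[≠] (3 / 2 : ℝ)) (𝓝[≠] ((3 / 2 : ℝ) : ℂ)) :=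
    Complex.continuous_ofReal.continuousAt.continuousWithinAt.tendsto_nhdsWithin
      fun t ht h => ht (Complex.ofReal_injective h)
  exact hmap.frequently (hreal.mono fun t ht => (hasSum_newton_of_mem_Icc ht).tsum_eq)

end NewtonZeta

theorem corollary1 (s : ℂ) :
    HasSum (fun n : ℕ => (-1 : ℂ) ^ n * NewtonZeta.b n * Ring.choose s n) (NewtonZeta.Z s) := by
  rw [← NewtonZeta.tsum_newton_eq_Z]
  exact (NewtonZeta.summable_newton s).hasSum
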